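/- Let $[\omega]^\omega$ be the set of infinite subsets of $\omega$. For a finite set $a\subseteq\omega$ and $A\in[\omega]^\omega$ put $$[a,A]=\{B\in[\omega]^\omega : a\sqsubset B\subseteq a\cup A\},$$ where $a\sqsubset B$ means that $a$ is an initial segment of $B$, i.e. $a\subseteq B$ and every element of $B\setminus a$ is larger than every element of $a$. The Ellentuck space is $[\omega]^\omega$ with the topology that has the sets $[a,A]$ as a base. A Kuratowski partition of a topological space $Y$ is a partition $\mathcal F$ of $Y$ into sets that are meager in $Y$ such that for every subfamily $\mathcal F'\subseteq\mathcal F$ the union $\bigcup\mathcal F'$ has the Baire property in $Y$ (i.e. differs from an open subset of $Y$ by a set meager in $Y$). **Proposition 4.** Let $X$ be a subset of the Ellentuck space that is not meager in it. Then $X$, with the subspace topology, admits no Kuratowski partition. -/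

import Mathlib

/-- The set `[ω]^ω` of infinite subsets of `ω`. -/
def EllentuckSpace : Type := {A : Set ℕ // A.Infinite}

namespace EllentuckSpace

/-- `a ⊏ B`: the finite set `a` is an initial segment of `B`. -/
def IsInitialSegment (a : Finset ℕ) (B : Set ℕ) : Prop :=
  (a : Set ℕ) ⊆ B ∧ ∀ m ∈ a, ∀ n ∈ B, n ∉ a → m < n

/-- The basis set `[a, A] = {B ∈ [ω]^ω : a ⊏ B ⊆ a ∪ A}`. -/
def basisSet (a : Finset ℕ) (A : EllentuckSpace) : Set EllentuckSpace :=
  {B | IsInitialSegment a B.1 ∧ B.1 ⊆ (a : Set ℕ) ∪ A.1}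

/-- The Ellentuck topology. -/
instance : TopologicalSpace EllentuckSpace :=
  TopologicalSpace.generateFrom {U | ∃ a A, U = basisSet a A}

/-- The sets `[a, A]` are a base, not merely a subbase, of the Ellentuck topology. -/
theorem isTopologicalBasis_basisSet :
    TopologicalSpace.IsTopologicalBasis {U : Set EllentuckSpace | ∃ a A, U = basisSet a A} := by
  refine ⟨?_, ?_, rfl⟩
  · rintro _ ⟨a, A, rfl⟩ _ ⟨b, B, rfl⟩ C ⟨⟨⟨ha, ha'⟩, hA⟩, ⟨⟨hb, hb'⟩, hB⟩⟩
    have key : ∀ c : Finset ℕ, IsInitialSegment c C.1 → a ⊆ c → b ⊆ c →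
        ∃ t ∈ {U | ∃ a A, U = basisSet a A}, C ∈ t ∧ t ⊆ basisSet a A ∩ basisSet b B := by
      intro c hc hac hbc
      refine ⟨basisSet c C, ⟨c, C, rfl⟩, ⟨hc, Set.subset_union_right⟩, ?_⟩
      rintro D ⟨⟨hcD, -⟩, hD⟩
      have hDC : D.1 ⊆ C.1 := fun x hx => (hD hx).elim (fun h => hc.1 h) id
      exact ⟨⟨⟨fun x hx => hcD (hac hx), fun m hm n hn => ha' m hm n (hDC hn)⟩,
          fun x hx => hA (hDC hx)⟩,
        ⟨⟨fun x hx => hcD (hbc hx), fun m hm n hn => hb' m hm n (hDC hn)⟩,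
          fun x hx => hB (hDC hx)⟩⟩
    by_cases hab : a ⊆ b
    · exact key b ⟨hb, hb'⟩ hab (Finset.Subset.refl b)
    · obtain ⟨x, hxa, hxb⟩ := Finset.not_subset.1 hab
      refine key a ⟨ha, ha'⟩ (Finset.Subset.refl a) fun y hy => ?_
      by_contra hya
      exact lt_asymm (ha' x hxa y (hb hy) hya) (hb' y hy x (ha hxa) hxb)
  · refine Set.eq_univ_of_forall fun B => ⟨basisSet ∅ B, ⟨∅, B, rfl⟩, ?_⟩
    exact ⟨⟨by simp, by simp⟩, Set.subset_union_right⟩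

end EllentuckSpace

/-- A Kuratowski partition of a topological space: a partition into meager sets such that the
union of every subfamily has the Baire property. -/
def IsKuratowskiPartition {X : Type*} [TopologicalSpace X] (F : Set (Set X)) : Prop :=
  Setoid.IsPartition F ∧ (∀ s ∈ F, IsMeagre s) ∧ ∀ F' ⊆ F, BaireMeasurableSet (⋃₀ F')

/-! Labelling each point by a representative of its cell turns a Kuratowski partition into a map
from X to the reals with meagre fibres, all of whose preimages have the Baire property. Open sets
are completely Ramsey (Ellentuck) and meagre sets are Ramsey null, so membership of the label in any
given set of reals can be decided on X ∩ [s, B] by shrinking B.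

Take [a, B] in which X is dense. The crux is `exists_forall_infinite_inter`: deciding the digits of
the label by fusion yields [a, P] in which points of X with finite intersection have different
labels. An almost disjoint family of continuum many subsets of P then gives continuum many labels,
so X ∩ [a, Q] carries continuum many labels for every Q ⊆ B. A Bernstein set of labels splits all
these label sets, so its preimage is decided on no [a, Q], a contradiction. -/

namespace EllentuckSpace

/-! ### Basic sets, tails and initial segments -/

theorem basisSet_mono (a : Finset ℕ) {P Q : EllentuckSpace} (h : Q.1 ⊆ P.1) :
    basisSet a Q ⊆ basisSet a P :=
  fun _ hC => ⟨hC.1, hC.2.trans (Set.union_subset_union_right _ h)⟩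

/-- The elements of `P` above `m`. -/
def tail (P : EllentuckSpace) (m : ℕ) : EllentuckSpace :=
  ⟨P.1 \ Set.Iic m, P.2.sdiff (Set.finite_Iic m)⟩

theorem mem_tail {P : EllentuckSpace} {m n : ℕ} : n ∈ (tail P m).1 ↔ n ∈ P.1 ∧ m < n := by
  simp [tail]

theorem tail_subset (P : EllentuckSpace) (m : ℕ) : (tail P m).1 ⊆ P.1 := Set.sdiff_subset

theorem tail_mono {P Q : EllentuckSpace} (h : Q.1 ⊆ P.1) (m : ℕ) : (tail Q m).1 ⊆ (tail P m).1 :=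
  Set.sdiff_subset_sdiff_left h

theorem tail_anti (P : EllentuckSpace) {m k : ℕ} (h : m ≤ k) : (tail P k).1 ⊆ (tail P m).1 :=
  Set.sdiff_subset_sdiff_right (Set.Iic_subset_Iic.2 h)

open Classical in
/-- The elements of `C` below `m`. -/
noncomputable def below (C : EllentuckSpace) (m : ℕ) : Finset ℕ :=
  (Finset.range m).filter (· ∈ C.1)

theorem mem_below {C : EllentuckSpace} {m n : ℕ} : n ∈ below C m ↔ n < m ∧ n ∈ C.1 := by
  simp [below]

theorem below_subset_range (C : EllentuckSpace) (m : ℕ) : below C m ⊆ Finset.range m :=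
  fun _ h => Finset.mem_range.2 (mem_below.1 h).1

theorem below_succ_of_mem {C : EllentuckSpace} {m : ℕ} (h : m ∈ C.1) :
    below C (m + 1) = insert m (below C m) := by
  ext n
  simp only [mem_below, Finset.mem_insert, Nat.lt_succ_iff_lt_or_eq]
  constructor
  · rintro ⟨h | h, h'⟩ <;> tauto
  · rintro (rfl | h)
    · tauto
    · tauto

theorem below_succ_of_notMem {C : EllentuckSpace} {m : ℕ} (h : m ∉ C.1) :
    below C (m + 1) = below C m := by
  ext n
  simp only [mem_below, Nat.lt_succ_iff_lt_or_eq]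
  constructor
  · rintro ⟨h | rfl, h'⟩ <;> tauto
  · tauto

theorem isInitialSegment_below (C : EllentuckSpace) (m : ℕ) : IsInitialSegment (below C m) C.1 := by
  refine ⟨fun n hn => (mem_below.1 hn).2, fun k hk n hn hn' => ?_⟩
  have h := (mem_below.1 hk).1
  have h' : ¬ n < m := fun h => hn' (mem_below.2 ⟨h, hn⟩)
  omega

theorem IsInitialSegment.below_sup_eq {a : Finset ℕ} {C : EllentuckSpace}
    (h : IsInitialSegment a C.1) : below C (a.sup Nat.succ) = a := by
  ext n
  rw [mem_below]
  constructor
  · rintro ⟨h1, h2⟩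
    by_contra hn
    have : a.sup Nat.succ ≤ n := Finset.sup_le fun k hk => h.2 k hk n h2 hn
    omega
  · exact fun hn => ⟨Finset.le_sup (f := Nat.succ) hn, h.1 hn⟩

/-- A point of `[a, P]` lies in `[C ∩ [0, m], P]` beyond `m`. -/
theorem mem_basisSet_below {a : Finset ℕ} {C P : EllentuckSpace} (h : C ∈ basisSet a P) {m : ℕ}
    (ha : a ⊆ Finset.range (m + 1)) : C ∈ basisSet (below C (m + 1)) (tail P m) := by
  refine ⟨isInitialSegment_below C _, fun n hn => ?_⟩
  by_cases hnm : n < m + 1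
  · exact Or.inl (mem_below.2 ⟨hnm, hn⟩)
  · refine Or.inr (mem_tail.2 ⟨(h.2 hn).resolve_left fun h' => hnm ?_, by omega⟩)
    exact Finset.mem_range.1 (ha h')

/-! ### Fusion -/

/-- Finitely many dense hereditary requirements can be met simultaneously. -/
theorem exists_subset_forall_mem {ι : Type*} {B : EllentuckSpace} {R : ι → EllentuckSpace → Prop}
    (anti : ∀ i (P Q : EllentuckSpace), Q.1 ⊆ P.1 → R i P → R i Q)
    (dense : ∀ i (P : EllentuckSpace), P.1 ⊆ B.1 → ∃ Q : EllentuckSpace, Q.1 ⊆ P.1 ∧ R i Q)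
    (I : Finset ι) (P : EllentuckSpace) (hP : P.1 ⊆ B.1) :
    ∃ Q : EllentuckSpace, Q.1 ⊆ P.1 ∧ ∀ i ∈ I, R i Q := by
  classical
  induction I using Finset.induction_on with
  | empty => exact ⟨P, subset_rfl, by simp⟩
  | insert i I _ ih =>
    obtain ⟨Q, hQ, hI⟩ := ih
    obtain ⟨Q', hQ', hi⟩ := dense i Q (hQ.trans hP)
    refine ⟨Q', hQ'.trans hQ, fun j hj => ?_⟩
    rcases Finset.mem_insert.1 hj with rfl | hj
    · exact hi
    · exact anti j Q Q' hQ' (hI j hj)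

/-- **Fusion**: given finitely many dense hereditary requirements for each `m`, some `P ⊆ B` has
the property that, for each `m ∈ P`, its part above `m` meets the requirements for `m`. -/
theorem exists_fusion {ι : Type*} {B : EllentuckSpace} {R : ι → EllentuckSpace → Prop}
    (anti : ∀ i (P Q : EllentuckSpace), Q.1 ⊆ P.1 → R i P → R i Q)
    (dense : ∀ i (P : EllentuckSpace), P.1 ⊆ B.1 → ∃ Q : EllentuckSpace, Q.1 ⊆ P.1 ∧ R i Q) (I : ℕ → Finset ι) :
    ∃ P : EllentuckSpace, P.1 ⊆ B.1 ∧ ∀ m ∈ P.1, ∀ i ∈ I m, R i (tail P m) := by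
  have step : ∀ P : EllentuckSpace, ∃ Q : EllentuckSpace, P.1 ⊆ B.1 →
      Q.1 ⊆ (tail P (sInf P.1)).1 ∧ ∀ i ∈ I (sInf P.1), R i Q := by
    intro P
    by_cases hP : P.1 ⊆ B.1
    · obtain ⟨Q, h⟩ := exists_subset_forall_mem anti dense (I (sInf P.1)) (tail P (sInf P.1))
        ((tail_subset _ _).trans hP)
      exact ⟨Q, fun _ => h⟩
    · exact ⟨P, fun h => absurd h hP⟩
  choose next hnext using step
  let S : ℕ → EllentuckSpace := fun n => next^[n] B
  have hS : ∀ n, S (n + 1) = next (S n) := fun n => Function.iterate_succ_apply' next n B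
  have hSB : ∀ n, (S n).1 ⊆ B.1 := by
    intro n
    induction n with
    | zero => exact subset_rfl
    | succ n ih => rw [hS]; exact (hnext _ ih).1.trans ((tail_subset _ _).trans ih)
  -- The minima of the stages form the fusion; its part above `b n` lies in stage `n + 1`.
  let b : ℕ → ℕ := fun n => sInf (S n).1
  have hb : ∀ n, b n ∈ (S n).1 := fun n => Nat.sInf_mem (S n).2.nonempty
  have hSs : ∀ n, (S (n + 1)).1 ⊆ (tail (S n) (b n)).1 := fun n => by
    rw [hS]; exact (hnext _ (hSB n)).1
  have hanti : Antitone fun n => (S n).1 :=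
    antitone_nat_of_succ_le fun n => (hSs n).trans (tail_subset _ _)
  have hmono : StrictMono b := strictMono_nat_of_lt_succ fun n => (mem_tail.1 (hSs n (hb _))).2
  refine ⟨⟨Set.range b, Set.infinite_range_of_injective hmono.injective⟩, ?_, ?_⟩
  · rintro _ ⟨n, rfl⟩
    exact hSB n (hb n)
  · rintro _ ⟨n, rfl⟩ i hi
    refine anti i (S (n + 1)) _ ?_ (by rw [hS]; exact (hnext _ (hSB n)).2 i hi)
    rintro _ hk
    obtain ⟨⟨k, rfl⟩, hk⟩ := mem_tail.1 hk
    exact hanti (Nat.succ_le_of_lt (hmono.lt_iff_lt.1 hk)) (hb k)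

/-! ### Ellentuck's theorem for open sets -/

/-- `O` rejects `(s, P)` if it contains `[s, Q]` for no `Q ⊆ P`. -/
def Rejects (O : Set EllentuckSpace) (s : Finset ℕ) (P : EllentuckSpace) : Prop :=
  ∀ Q : EllentuckSpace, Q.1 ⊆ P.1 → ¬ basisSet s Q ⊆ O

theorem Rejects.mono {O : Set EllentuckSpace} {s : Finset ℕ} {P Q : EllentuckSpace}
    (h : Rejects O s P) (hQ : Q.1 ⊆ P.1) : Rejects O s Q :=
  fun Q' hQ' => h Q' (hQ'.trans hQ)

theorem exists_subset_or_rejects (O : Set EllentuckSpace) (s : Finset ℕ) (P : EllentuckSpace) :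
    ∃ Q : EllentuckSpace, Q.1 ⊆ P.1 ∧ (basisSet s Q ⊆ O ∨ Rejects O s Q) := by
  by_cases h : Rejects O s P
  · exact ⟨P, subset_rfl, Or.inr h⟩
  · simp only [Rejects, not_forall, not_not] at h
    obtain ⟨Q, hQ, h⟩ := h
    exact ⟨Q, hQ, Or.inl h⟩

/-- `[insert p s, P]` only depends on the part of `P` above `p`. -/
theorem basisSet_insert_subset_tail {s : Finset ℕ} {p : ℕ} (P : EllentuckSpace) :
    basisSet (insert p s) P ⊆ basisSet (insert p s) (tail P p) := by
  rintro C ⟨h1, h2⟩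
  refine ⟨h1, fun n hn => ?_⟩
  by_cases hn' : n ∈ insert p s
  · exact Or.inl hn'
  · exact Or.inr (mem_tail.2 ⟨(h2 hn).resolve_left hn', h1.2 p (Finset.mem_insert_self _ _) n hn hn'⟩)

theorem exists_mem_basisSet_insert {s : Finset ℕ} {C P : EllentuckSpace} (h : C ∈ basisSet s P) :
    ∃ p ∈ P.1, (∀ k ∈ s, k < p) ∧ C ∈ basisSet (insert p s) P := by
  classical
  have hne : (C.1 \ (s : Set ℕ)).Nonempty := (C.2.sdiff s.finite_toSet).nonempty
  obtain ⟨h1, h2⟩ := Nat.sInf_mem hne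
  set p := sInf (C.1 \ (s : Set ℕ)) with hp
  refine ⟨p, (h.2 h1).resolve_left h2, fun k hk => h.1.2 k hk p h1 h2, ⟨?_, ?_⟩, ?_⟩
  · intro n hn
    rcases Finset.mem_insert.1 hn with rfl | hn
    · exact h1
    · exact h.1.1 hn
  · intro m hm n hn hn'
    rw [Finset.mem_insert, not_or] at hn'
    rcases Finset.mem_insert.1 hm with rfl | hm
    · exact lt_of_le_of_ne (Nat.sInf_le ⟨hn, hn'.2⟩) (Ne.symm hn'.1)
    · exact h.1.2 m hm n hn hn'.2
  · refine h.2.trans (Set.union_subset_union_left _ ?_)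
    exact_mod_cast Finset.subset_insert _ _

/-- After a fusion every `insert p s` is accepted or rejected. If infinitely many `p` are accepted,
they alone form `Q`, since each point of [s, Q] has a first element beyond `s`; otherwise the
finitely many accepted ones are discarded. -/
theorem exists_subset_or_forall_rejects_insert (O : Set EllentuckSpace) (s : Finset ℕ)
    (B : EllentuckSpace) : ∃ Q : EllentuckSpace, Q.1 ⊆ B.1 ∧
      (basisSet s Q ⊆ O ∨ ∀ p ∈ Q.1, (∀ k ∈ s, k < p) → Rejects O (insert p s) Q) := by
  classical
  obtain ⟨P, hPB, hP⟩ := exists_fusion (B := B)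
    (R := fun s Q => basisSet s Q ⊆ O ∨ Rejects O s Q)
    (fun s P Q hQ h => h.imp (fun h => (basisSet_mono s hQ).trans h) fun h => h.mono hQ)
    (fun s P _ => exists_subset_or_rejects O s P) (fun m => (Finset.range (m + 1)).powerset)
  by_cases hA : {p ∈ P.1 | (∀ k ∈ s, k < p) ∧ basisSet (insert p s) (tail P p) ⊆ O}.Infinite
  · refine ⟨⟨_, hA⟩, fun p hp => hPB hp.1, Or.inl fun C hC => ?_⟩
    obtain ⟨p, hp, -, hC'⟩ := exists_mem_basisSet_insert hC
    refine hp.2.2 (basisSet_insert_subset_tail _ (basisSet_mono _ ?_ hC'))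
    exact fun q hq => hq.1
  · rw [Set.not_infinite] at hA
    refine ⟨⟨_, P.2.sdiff hA⟩, Set.sdiff_subset.trans hPB, Or.inr fun p hp hs => ?_⟩
    have hins : insert p s ∈ (Finset.range (p + 1)).powerset := by
      refine Finset.mem_powerset.2 (Finset.insert_subset (by simp) fun k hk => ?_)
      exact Finset.mem_range.2 ((hs k hk).trans (Nat.lt_succ_self p))
    have hrej := (hP p hp.1 _ hins).resolve_left fun h => hp.2 ⟨hp.1, hs, h⟩
    intro Q hQ hQO
    refine hrej (tail Q p) (tail_mono (hQ.trans Set.sdiff_subset) p) ?_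
    exact (basisSet_mono _ (tail_subset _ _)).trans hQO

/-- **Ellentuck's theorem** for open sets: they are completely Ramsey. -/
theorem exists_basisSet_subset_or_disjoint {O : Set EllentuckSpace} (hO : IsOpen O) (a : Finset ℕ)
    (B : EllentuckSpace) : ∃ P : EllentuckSpace, P.1 ⊆ B.1 ∧
      (basisSet a P ⊆ O ∨ Disjoint (basisSet a P) O) := by
  classical
  let R : Finset ℕ → EllentuckSpace → Prop := fun s Q =>
    basisSet s Q ⊆ O ∨ ∀ p ∈ Q.1, (∀ k ∈ s, k < p) → Rejects O (insert p s) Q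
  have anti : ∀ s P Q, Q.1 ⊆ P.1 → R s P → R s Q := fun s P Q hQ h =>
    h.imp (fun h => (basisSet_mono s hQ).trans h) fun h p hp hs => (h p (hQ hp) hs).mono hQ
  obtain ⟨P₀, hP₀, ha⟩ := exists_subset_or_forall_rejects_insert O a B
  rcases ha with ha | ha
  · exact ⟨P₀, hP₀, Or.inl ha⟩
  obtain ⟨P, hP, hR⟩ := exists_fusion (B := P₀) anti
    (fun s P _ => exists_subset_or_forall_rejects_insert O s P)
    (fun m => (Finset.range (m + 1)).powerset)
  refine ⟨P, hP.trans hP₀, Or.inr (Set.disjoint_left.2 fun C hC hCO => ?_)⟩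
  -- Rejection spreads along the initial segments of `C`: if C ∩ [0, m] is rejected, it is not
  -- accepted, so `hR` rejects its one-point extensions.
  have key : ∀ m, a.sup Nat.succ ≤ m → ∀ p ∈ P.1, m ≤ p →
      Rejects O (insert p (below C m)) (tail P p) := by
    intro m hm
    induction m, hm using Nat.le_induction with
    | base =>
      intro p hp hmp
      rw [hC.1.below_sup_eq]
      refine (ha p (hP hp) fun k hk => ?_).mono ((tail_subset _ _).trans hP)
      exact (Finset.le_sup (f := Nat.succ) hk).trans hmp
    | succ m hm ih =>
      intro p hp hmp
      by_cases hmC : m ∈ C.1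
      · have hmP : m ∈ P.1 := (hC.2 hmC).resolve_left fun h =>
          absurd (Finset.le_sup (f := Nat.succ) h) (by omega)
        have hrej := ih m hmP le_rfl
        rw [← below_succ_of_mem hmC] at hrej
        have hR' := (hR m hmP _ (Finset.mem_powerset.2 (below_subset_range C (m + 1)))).resolve_left
          (hrej _ subset_rfl)
        refine (hR' p (mem_tail.2 ⟨hp, hmp⟩) fun k hk => ?_).mono (tail_anti _ (by omega))
        exact (mem_below.1 hk).1.trans_le hmp
      · rw [below_succ_of_notMem hmC]
        exact ih p hp (by omega)
  -- A basic neighbourhood of `C` inside `O` shows that a long initial segment of `C` is not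
  -- rejected.
  obtain ⟨_, ⟨c, A, rfl⟩, hCc, hcO⟩ :=
    isTopologicalBasis_basisSet.exists_subset_of_mem_open hCO hO
  obtain ⟨p, hpC, hp⟩ := C.2.exists_gt (max (a.sup Nat.succ) (c.sup Nat.succ))
  have hpP : p ∈ P.1 := (hC.2 hpC).resolve_left fun h => by
    have := Finset.le_sup (f := Nat.succ) h
    have := le_max_left (a.sup Nat.succ) (c.sup Nat.succ)
    omega
  have hrej := key p (by have := le_max_left (a.sup Nat.succ) (c.sup Nat.succ); omega) p hpP le_rfl
  rw [← below_succ_of_mem hpC] at hrej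
  refine hrej (tail C p) (fun n hn => ?_) fun D hD => hcO ?_
  · obtain ⟨hnC, hpn⟩ := mem_tail.1 hn
    refine mem_tail.2 ⟨(hC.2 hnC).resolve_left fun h => ?_, hpn⟩
    have := Finset.le_sup (f := Nat.succ) h
    have := le_max_left (a.sup Nat.succ) (c.sup Nat.succ)
    omega
  · have hDC : D.1 ⊆ C.1 := fun n hn => (hD.2 hn).elim (fun h => (mem_below.1 h).2)
      fun h => tail_subset _ _ h
    refine ⟨⟨fun n hn => hD.1.1 (mem_below.2 ⟨?_, hCc.1.1 hn⟩), fun m hm n hn =>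
      hCc.1.2 m hm n (hDC hn)⟩, hDC.trans hCc.2⟩
    have := Finset.le_sup (f := Nat.succ) hn
    have := le_max_right (a.sup Nat.succ) (c.sup Nat.succ)
    omega

/-! ### Meagre sets are Ramsey null -/

/-- Ramsey null sets: every `[a, B]` shrinks to some `[a, P]` that misses the set. -/
def RamseyNull (N : Set EllentuckSpace) : Prop :=
  ∀ (a : Finset ℕ) (B : EllentuckSpace),
    ∃ P : EllentuckSpace, P.1 ⊆ B.1 ∧ Disjoint (basisSet a P) N

theorem basisSet_nonempty (a : Finset ℕ) (B : EllentuckSpace) : (basisSet a B).Nonempty := by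
  refine ⟨⟨(a : Set ℕ) ∪ (tail B (a.sup id)).1, (tail B _).2.mono Set.subset_union_right⟩,
    ⟨Set.subset_union_left, fun m hm n hn hna => ?_⟩, ?_⟩
  · have h := (mem_tail.1 (hn.resolve_left hna)).2
    exact (Finset.le_sup (f := id) hm).trans_lt h
  · exact Set.union_subset_union_right _ (tail_subset _ _)

theorem isOpen_basisSet (a : Finset ℕ) (B : EllentuckSpace) : IsOpen (basisSet a B) :=
  isTopologicalBasis_basisSet.isOpen ⟨a, B, rfl⟩

/-- Ellentuck's theorem is applied to the complement of the closure; a basic set inside the closure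
would contradict its empty interior. -/
theorem RamseyNull.of_isNowhereDense {N : Set EllentuckSpace} (hN : IsNowhereDense N) :
    RamseyNull N := by
  intro a B
  obtain ⟨P, hP, h | h⟩ := exists_basisSet_subset_or_disjoint
    (isClosed_closure (s := N)).isOpen_compl a B
  · exact ⟨P, hP, Set.disjoint_left.2 fun C hC hCN => h hC (subset_closure hCN)⟩
  · rw [Set.disjoint_compl_right_iff_subset] at h
    have h' := interior_maximal h (isOpen_basisSet a P)
    rw [hN] at h'
    exact absurd (h' (basisSet_nonempty a P).some_mem) (Set.notMem_empty _)

theorem RamseyNull.iUnion {N : ℕ → Set EllentuckSpace} (hN : ∀ n, RamseyNull (N n)) :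
    RamseyNull (⋃ n, N n) := by
  intro a B
  obtain ⟨P, hP, hd⟩ := exists_fusion (B := B)
    (R := fun (i : Finset ℕ × ℕ) Q => Disjoint (basisSet i.1 Q) (N i.2))
    (fun i P Q hQ h => h.mono_left (basisSet_mono _ hQ)) (fun i P _ => hN i.2 i.1 P)
    (fun m => (Finset.range (m + 1)).powerset ×ˢ Finset.range (m + 1))
  refine ⟨P, hP, Set.disjoint_left.2 fun C hC hCN => ?_⟩
  obtain ⟨n, hn⟩ := Set.mem_iUnion.1 hCN
  obtain ⟨m, hmP, hm⟩ := P.2.exists_gt (max n (a.sup id))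
  refine Set.disjoint_left.1 (hd m hmP (below C (m + 1), n) ?_)
    (mem_basisSet_below hC fun k hk => ?_) hn
  · have := le_max_left n (a.sup id)
    exact Finset.mem_product.2 ⟨Finset.mem_powerset.2 (below_subset_range _ _),
      Finset.mem_range.2 (by omega)⟩
  · have : k ≤ a.sup id := Finset.le_sup (f := id) hk
    have := le_max_right n (a.sup id)
    exact Finset.mem_range.2 (by omega)

theorem RamseyNull.mono {M N : Set EllentuckSpace} (hN : RamseyNull N) (h : M ⊆ N) :
    RamseyNull M := fun a B =>
  let ⟨P, hP, hd⟩ := hN a B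
  ⟨P, hP, hd.mono_right h⟩

theorem RamseyNull.iUnion_countable {ι : Type*} [Countable ι] {N : ι → Set EllentuckSpace}
    (hN : ∀ i, RamseyNull (N i)) : RamseyNull (⋃ i, N i) := by
  cases isEmpty_or_nonempty ι
  · intro a B
    exact ⟨B, subset_rfl, by simp⟩
  · obtain ⟨f, hf⟩ := exists_surjective_nat ι
    refine (RamseyNull.iUnion fun n => hN (f n)).mono ?_
    rw [hf.iUnion_comp]

theorem RamseyNull.of_isMeagre {N : Set EllentuckSpace} (hN : IsMeagre N) : RamseyNull N := by
  obtain ⟨S, hS, hc, hNS⟩ := isMeagre_iff_countable_union_isNowhereDense.1 hN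
  have := hc.to_subtype
  rw [Set.sUnion_eq_iUnion] at hNS
  exact (RamseyNull.iUnion_countable fun s : S => of_isNowhereDense (hS s s.2)).mono hNS

/-! ### Labellings by reals -/

theorem basisSet_below_subset {a : Finset ℕ} {C P Q : EllentuckSpace} (h : C ∈ basisSet a P) {m : ℕ}
    (ha : a ⊆ Finset.range m) (hQ : Q.1 ⊆ P.1) : basisSet (below C m) Q ⊆ basisSet a P := by
  intro E hE
  have hab : ∀ x ∈ a, x ∈ below C m := fun x hx =>
    mem_below.2 ⟨Finset.mem_range.1 (ha hx), h.1.1 hx⟩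
  refine ⟨⟨fun x hx => hE.1.1 (hab x hx), fun x hx y hy hya => ?_⟩, fun y hy => ?_⟩
  · by_cases hyb : y ∈ below C m
    · exact h.1.2 x hx y (mem_below.1 hyb).2 hya
    · exact hE.1.2 x (hab x hx) y hy hyb
  · rcases hE.2 hy with hy | hy
    · exact h.2 (mem_below.1 hy).2
    · exact Or.inr (hQ hy)

/-- Let `g` be a labelling of `X` by reals whose fibres are Ramsey null and each of whose digits can
be decided on `X ∩ [s, B]` by shrinking `B`. If `X` is dense in `[a, B]` then on some `[a, P]`,
points with the same label have infinite intersection. -/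
theorem exists_forall_infinite_inter {X : Set EllentuckSpace} {g : EllentuckSpace → Set ℕ}
    (hdec : ∀ (n : ℕ) (s : Finset ℕ) (B : EllentuckSpace), ∃ P : EllentuckSpace, P.1 ⊆ B.1 ∧
      ((∀ C ∈ X, C ∈ basisSet s P → n ∈ g C) ∨ ∀ C ∈ X, C ∈ basisSet s P → n ∉ g C))
    (hnull : ∀ z, RamseyNull {C | C ∈ X ∧ g C = z}) {a : Finset ℕ} {B : EllentuckSpace}
    (hX : ∀ s P, basisSet s P ⊆ basisSet a B → (X ∩ basisSet s P).Nonempty) :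
    ∃ P : EllentuckSpace, P.1 ⊆ B.1 ∧ ∀ C ∈ X, C ∈ basisSet a P → ∀ D ∈ X, D ∈ basisSet a P →
      g C = g D → (C.1 ∩ D.1).Infinite := by
  obtain ⟨P₁, hP₁, hd₁⟩ := exists_fusion (B := B)
    (R := fun (i : Finset ℕ × ℕ) Q => (∀ C ∈ X, C ∈ basisSet i.1 Q → i.2 ∈ g C) ∨
      ∀ C ∈ X, C ∈ basisSet i.1 Q → i.2 ∉ g C)
    (fun i P Q hQ h => h.imp (fun h C hC hCQ => h C hC (basisSet_mono _ hQ hCQ))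
      fun h C hC hCQ => h C hC (basisSet_mono _ hQ hCQ))
    (fun i P _ => hdec i.2 i.1 P)
    (fun m => (Finset.range (m + 1)).powerset ×ˢ Finset.range (m + 1))
  have hd : ∀ m ∈ P₁.1, ∀ s ⊆ Finset.range (m + 1), ∀ n ≤ m,
      (∀ C ∈ X, C ∈ basisSet s (tail P₁ m) → n ∈ g C) ∨
        ∀ C ∈ X, C ∈ basisSet s (tail P₁ m) → n ∉ g C := fun m hm s hs n hn =>
    hd₁ m hm (s, n) (Finset.mem_product.2 ⟨Finset.mem_powerset.2 hs,
      Finset.mem_range.2 (Nat.lt_succ_of_le hn)⟩)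
  -- The label predicted by `s`: the digits forced on some tail.
  let e : Finset ℕ → Set ℕ := fun s =>
    {n | ∃ k, ∀ C ∈ X, C ∈ basisSet s (tail P₁ k) → n ∈ g C}
  have he : ∀ s n, ∃ k, ∀ C ∈ X, C ∈ basisSet s (tail P₁ k) → (n ∈ g C ↔ n ∈ e s) := by
    intro s n
    by_cases hn : n ∈ e s
    · obtain ⟨k, hk⟩ := hn
      exact ⟨k, fun C hC hCs => iff_of_true (hk C hC hCs) ⟨k, hk⟩⟩
    · obtain ⟨m, hmP, hm⟩ := P₁.2.exists_gt (max n (s.sup id))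
      refine ⟨m, fun C hC hCs => iff_of_false ?_ hn⟩
      refine (hd m hmP s (fun x hx => ?_) n ?_).resolve_left (fun h => hn ⟨m, h⟩) C hC hCs
      · have : x ≤ s.sup id := Finset.le_sup (f := id) hx
        have := le_max_right n (s.sup id)
        exact Finset.mem_range.2 (by omega)
      · exact (le_max_left _ _).trans hm.le
  -- Segments with different predictions are made to carry disjoint sets of labels.
  obtain ⟨P₂, hP₂, hd₂⟩ := exists_fusion (B := P₁)
    (R := fun (i : Finset ℕ × Finset ℕ) Q => e i.1 ≠ e i.2 → ∀ C ∈ X, ∀ D ∈ X,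
      C ∈ basisSet i.1 Q → D ∈ basisSet i.2 Q → g C ≠ g D)
    (fun i P Q hQ h hi C hC D hD hCQ hDQ =>
      h hi C hC D hD (basisSet_mono _ hQ hCQ) (basisSet_mono _ hQ hDQ))
    (by
      rintro ⟨s, t⟩ P hP
      by_cases hst : e s = e t
      · exact ⟨P, subset_rfl, fun h => absurd hst h⟩
      · obtain ⟨n, hn⟩ : ∃ n, ¬ (n ∈ e s ↔ n ∈ e t) := by
          by_contra! h
          exact hst (Set.ext h)
        obtain ⟨k, hk⟩ := he s n
        obtain ⟨l, hl⟩ := he t n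
        refine ⟨tail P (max k l), tail_subset _ _, fun _ C hC D hD hCQ hDQ hg => hn ?_⟩
        rw [← hk C hC (basisSet_mono _ ((tail_mono hP _).trans (tail_anti _ (le_max_left _ _))) hCQ),
          ← hl D hD (basisSet_mono _ ((tail_mono hP _).trans (tail_anti _ (le_max_right _ _))) hDQ),
          hg])
    (fun m => (Finset.range (m + 1)).powerset ×ˢ (Finset.range (m + 1)).powerset)
  -- There are only countably many predictions, so the points whose label is one of them can be
  -- avoided.
  obtain ⟨P, hP, hPe⟩ := RamseyNull.iUnion_countable (fun s => hnull (e s)) a P₂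
  refine ⟨P, hP.trans (hP₂.trans hP₁), fun C hCX hC D hDX hD hg => ?_⟩
  intro hfin
  obtain ⟨M, hM⟩ := hfin.bddAbove
  obtain ⟨m₀, hm₀P, hm₀⟩ := P.2.exists_gt (max M (a.sup id))
  have hM₀ : M < m₀ := (le_max_left _ _).trans_lt hm₀
  have ha₀ : ∀ x ∈ a, x < m₀ := fun x hx =>
    (Finset.le_sup (f := id) hx).trans_lt ((le_max_right _ _).trans_lt hm₀)
  have hC₂ := basisSet_mono a hP hC
  have hD₂ := basisSet_mono a hP hD
  have har : ∀ m, m₀ ≤ m → a ⊆ Finset.range (m + 1) := fun m hm x hx =>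
    Finset.mem_range.2 (by have := ha₀ x hx; omega)
  have heq_mem : ∀ m, m₀ ≤ m → m ∈ P₂.1 → e (below C (m + 1)) = e (below D (m + 1)) := by
    intro m hm hmP
    by_contra hne
    exact hd₂ m hmP (below C (m + 1), below D (m + 1))
      (Finset.mem_product.2 ⟨Finset.mem_powerset.2 (below_subset_range _ _),
        Finset.mem_powerset.2 (below_subset_range _ _)⟩) hne C hCX D hDX
      (mem_basisSet_below hC₂ (har m hm)) (mem_basisSet_below hD₂ (har m hm)) hg
  have heq : ∀ m, m₀ ≤ m → e (below C (m + 1)) = e (below D (m + 1)) := by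
    intro m hm
    induction m, hm using Nat.le_induction with
    | base => exact heq_mem m₀ le_rfl (hP hm₀P)
    | succ m hm ih =>
      by_cases hmP : m + 1 ∈ P₂.1
      · exact heq_mem _ (by omega) hmP
      · have hma : m + 1 ∉ (a : Set ℕ) := fun h => by have := ha₀ _ h; omega
        rw [below_succ_of_notMem fun h => (hC₂.2 h).elim hma hmP,
          below_succ_of_notMem fun h => (hD₂.2 h).elim hma hmP, ih]
  -- Beyond `m₀` at most one of `C`, `D` gains an element at a time, and the other keeps the common
  -- prediction fixed. Hence `g C` is itself a prediction, which `P` excludes.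
  have hconst : ∀ m, m₀ ≤ m → e (below C (m + 1)) = e (below C (m₀ + 1)) := by
    intro m hm
    induction m, hm using Nat.le_induction with
    | base => rfl
    | succ m hm ih =>
      by_cases hmC : m + 1 ∈ C.1
      · have hmD : m + 1 ∉ D.1 := fun h => by have := hM ⟨hmC, h⟩; omega
        rw [heq _ (by omega), below_succ_of_notMem hmD, ← heq _ hm, ih]
      · rw [below_succ_of_notMem hmC, ih]
  refine Set.disjoint_left.1 hPe hC (Set.mem_iUnion.2 ⟨below C (m₀ + 1), hCX, ?_⟩)
  ext n
  obtain ⟨m, hmP, hm⟩ := P.2.exists_gt (max n m₀)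
  have hm₀m : m₀ ≤ m := (le_max_right _ _).trans hm.le
  have hC₁ := basisSet_mono a hP₂ hC₂
  have hCm := mem_basisSet_below hC₁ (har m hm₀m)
  rw [← hconst m hm₀m]
  rcases hd m (hP₂ (hP hmP)) _ (below_subset_range C (m + 1)) n ((le_max_left _ _).trans hm.le)
    with h | h
  · exact iff_of_true (h C hCX hCm) ⟨m, h⟩
  · refine iff_of_false (h C hCX hCm) ?_
    rintro ⟨k, hk⟩
    -- Density of `X` gives a point on which the digit would be forced both ways.
    obtain ⟨E, hEX, hE⟩ := hX (below C (m + 1)) (tail P₁ (max k m))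
      ((basisSet_below_subset hC₁ (har m hm₀m) (tail_subset _ _)).trans (basisSet_mono a hP₁))
    exact h E hEX (basisSet_mono _ (tail_anti _ (le_max_right _ _)) hE)
      (hk E hEX (basisSet_mono _ (tail_anti _ (le_max_left _ _)) hE))

/-! ### Almost disjoint families and Bernstein sets -/

/-- Every infinite set has an almost disjoint family of infinite subsets indexed by `2 ^ ω`. -/
theorem exists_almostDisjoint (P : EllentuckSpace) : ∃ A : (ℕ → Bool) → EllentuckSpace,
    (∀ x, (A x).1 ⊆ P.1) ∧ ∀ x y, x ≠ y → ((A x).1 ∩ (A y).1).Finite := by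
  let p := P.2.natEmbedding
  -- The branch `x` is sent to the codes of its finite initial segments.
  let c : (ℕ → Bool) → ℕ → ℕ := fun x n => p (Encodable.encode ((List.range n).map x))
  have hc : ∀ x y n m, c x n = c y m → n = m ∧ ∀ i < n, x i = y i := by
    intro x y n m h
    have h' : (List.range n).map x = (List.range m).map y :=
      Encodable.encode_injective (p.injective (Subtype.ext h))
    have hnm : n = m := by simpa using congrArg List.length h'
    subst hnm
    refine ⟨rfl, fun i hi => ?_⟩
    exact List.map_inj_left.1 h' i (List.mem_range.2 hi)
  refine ⟨fun x => ⟨Set.range (c x), Set.infinite_range_of_injective fun n m h => (hc _ _ _ _ h).1⟩,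
    ?_, fun x y hxy => ?_⟩
  · rintro x _ ⟨n, rfl⟩
    exact (p _).2
  · obtain ⟨i, hi⟩ := Function.ne_iff.1 hxy
    refine ((Set.finite_Iic i).image (c x)).subset ?_
    rintro _ ⟨⟨n, rfl⟩, m, h⟩
    refine ⟨n, ?_, rfl⟩
    by_contra hn
    exact hi ((hc _ _ _ _ h.symm).2 i (by simpa using hn))

end EllentuckSpace

open Cardinal in
/-- Sets of size at least that of the index type have an injective choice function. -/
theorem exists_injective_forall_mem {J α : Type*} (V : J → Set α)
    (hV : ∀ j, Nonempty (J ↪ V j)) : ∃ φ : J → α, Function.Injective φ ∧ ∀ j, φ j ∈ V j := by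
  -- In a well-order of least type, fewer than #J values are taken before stage `j`, too few to
  -- exhaust `V j`.
  obtain ⟨r, wo, hr⟩ := Cardinal.exists_ord_eq J
  have step : ∀ (j : J) (f : (i : J) → r i j → α), ∃ x ∈ V j, ∀ i (h : r i j), x ≠ f i h := by
    intro j f
    by_contra! hcon
    choose i hi hf using hcon
    obtain ⟨v⟩ := hV j
    have hlt : #{i // r i j} < #J := Cardinal.card_typein_lt j hr
    refine absurd hlt (not_lt.2 (Cardinal.mk_le_of_injective
      (f := fun k : J => (⟨i (v k) (v k).2, hi _ _⟩ : {i // r i j})) fun k l hkl => ?_))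
    refine v.injective (Subtype.ext ?_)
    rw [hf _ (v k).2, hf _ (v l).2]
    congr 1
    exact congrArg Subtype.val hkl
  choose next hmem hne using step
  let φ : J → α := wo.wf.fix next
  have hφ : ∀ j, φ j = next j fun i _ => φ i := fun j => wo.wf.fix_eq next j
  refine ⟨φ, fun i j hij => ?_, fun j => by rw [hφ]; exact hmem _ _⟩
  rcases trichotomous_of r i j with h | h | h
  · exact absurd hij.symm (by rw [hφ j]; exact hne j _ i h)
  · exact h
  · exact absurd hij (by rw [hφ i]; exact hne i _ j h)

/-- A **Bernstein set**: one that splits each of at most continuum many sets of size continuum. -/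
theorem exists_splitting_set {J α : Type*} (hJ : Nonempty (J ↪ Set ℕ)) (V : J → Set α)
    (hV : ∀ j, ∃ f : (ℕ → Bool) → α, Function.Injective f ∧ ∀ x, f x ∈ V j) :
    ∃ S : Set α, ∀ j, (∃ x ∈ V j, x ∈ S) ∧ ∃ x ∈ V j, x ∉ S := by
  classical
  obtain ⟨u⟩ := hJ
  -- Indexing by `J × Bool` reserves two points of each `V j`, one inside `S` and one outside; `w`
  -- shows that there are at most continuum many indices.
  let w : J × Bool → ℕ → Bool := fun i n => if n = 0 then i.2 else decide (n - 1 ∈ u i.1)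
  have hw : Function.Injective w := by
    rintro ⟨i, b⟩ ⟨j, c⟩ h
    have hbc : b = c := by simpa [w] using congrFun h 0
    have hij : u i = u j := by
      ext n
      simpa [w] using congrFun h (n + 1)
    rw [hbc, u.injective hij]
  obtain ⟨φ, hφ, hmem⟩ := exists_injective_forall_mem (fun i : J × Bool => V i.1) (by
    rintro ⟨j, _⟩
    obtain ⟨f, hf, hfV⟩ := hV j
    exact ⟨⟨fun i => ⟨f (w i), hfV _⟩, fun i k h => hw (hf (congrArg Subtype.val h))⟩⟩)
  refine ⟨Set.range fun j => φ (j, true), fun j =>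
    ⟨⟨φ (j, true), hmem (j, true), j, rfl⟩, ⟨φ (j, false), hmem (j, false), ?_⟩⟩⟩
  rintro ⟨k, hk⟩
  simpa using congrArg Prod.snd (hφ hk)

namespace EllentuckSpace

/-! ### The Bernstein argument on a nonmeagre set -/

/-- Sets with the Baire property in `X` are completely Ramsey relative to `X`. -/
theorem exists_decides_of_baireMeasurableSet {X : Set EllentuckSpace} {S : Set X}
    (hS : BaireMeasurableSet S) (s : Finset ℕ) (B : EllentuckSpace) :
    ∃ P : EllentuckSpace, P.1 ⊆ B.1 ∧
      ((∀ C : X, C.1 ∈ basisSet s P → C ∈ S) ∨ ∀ C : X, C.1 ∈ basisSet s P → C ∉ S) := by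
  obtain ⟨U, hU, hSU⟩ := hS.residualEq_isOpen
  obtain ⟨O, hO, rfl⟩ := isOpen_induced_iff.1 hU
  have hN : IsMeagre {C : X | ¬ (C ∈ S ↔ C.1 ∈ O)} := by
    have : {C : X | C ∈ S ↔ C.1 ∈ O} ∈ residual X := by
      filter_upwards [hSU] with C hC
      exact iff_of_eq hC
    simpa only [IsMeagre, Set.compl_ofPred, not_not] using this
  obtain ⟨P, hP, hPN⟩ := RamseyNull.of_isMeagre hN.image_val s B
  have hiff : ∀ C : X, C.1 ∈ basisSet s P → (C ∈ S ↔ C.1 ∈ O) := fun C hC => by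
    by_contra h
    exact Set.disjoint_left.1 hPN hC ⟨C, h, rfl⟩
  obtain ⟨Q, hQ, h | h⟩ := exists_basisSet_subset_or_disjoint hO s P
  · exact ⟨Q, hQ.trans hP, Or.inl fun C hC => (hiff C (basisSet_mono s hQ hC)).2 (h hC)⟩
  · exact ⟨Q, hQ.trans hP, Or.inr fun C hC hCS =>
      Set.disjoint_left.1 h hC ((hiff C (basisSet_mono s hQ hC)).1 hCS)⟩

theorem exists_dense_basisSet {X : Set EllentuckSpace} (hX : ¬ IsMeagre X) :
    ∃ a B, ∀ s P, basisSet s P ⊆ basisSet a B → (X ∩ basisSet s P).Nonempty := by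
  have hne : (interior (closure X)).Nonempty := Set.nonempty_iff_ne_empty.2 fun h =>
    hX (IsNowhereDense.isMeagre h)
  obtain ⟨C, hC⟩ := hne
  obtain ⟨_, ⟨a, B, rfl⟩, -, hB⟩ :=
    isTopologicalBasis_basisSet.exists_subset_of_mem_open hC isOpen_interior
  refine ⟨a, B, fun s P h => ?_⟩
  obtain ⟨D, hD⟩ := basisSet_nonempty s P
  rw [Set.inter_comm]
  exact mem_closure_iff.1 (interior_subset (hB (h hD))) _ (isOpen_basisSet s P) hD

/-- A nonmeagre set has no labelling by reals with meagre fibres under which the preimage of every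
set of reals has the Baire property. -/
theorem not_forall_baireMeasurableSet_preimage {X : Set EllentuckSpace} (hX : ¬ IsMeagre X)
    (f : X → Set ℕ) (hf : ∀ z, IsMeagre (f ⁻¹' {z})) : ¬ ∀ S, BaireMeasurableSet (f ⁻¹' S) := by
  classical
  intro hS
  obtain ⟨a, B, hdense⟩ := exists_dense_basisSet hX
  let g : EllentuckSpace → Set ℕ := fun C => if h : C ∈ X then f ⟨C, h⟩ else ∅
  have hg : ∀ C (h : C ∈ X), g C = f ⟨C, h⟩ := fun C h => dif_pos h
  have hnull : ∀ z, RamseyNull {C | C ∈ X ∧ g C = z} := fun z =>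
    (RamseyNull.of_isMeagre (hf z).image_val).mono fun C hC =>
      ⟨⟨C, hC.1⟩, by simpa [hg C hC.1] using hC.2, rfl⟩
  have hdec : ∀ (n : ℕ) (s : Finset ℕ) (B : EllentuckSpace), ∃ P : EllentuckSpace, P.1 ⊆ B.1 ∧
      ((∀ C ∈ X, C ∈ basisSet s P → n ∈ g C) ∨ ∀ C ∈ X, C ∈ basisSet s P → n ∉ g C) := by
    intro n s B
    obtain ⟨P, hP, h⟩ := exists_decides_of_baireMeasurableSet (hS {z | n ∈ z}) s B
    refine ⟨P, hP, h.imp (fun h C hC hCP => ?_) fun h C hC hCP => ?_⟩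
    · rw [hg C hC]; exact h ⟨C, hC⟩ hCP
    · rw [hg C hC]; exact h ⟨C, hC⟩ hCP
  obtain ⟨S, hsplit⟩ := exists_splitting_set (J := {P : EllentuckSpace // P.1 ⊆ B.1})
    ⟨⟨fun P => P.1.1, fun P Q h => Subtype.ext (Subtype.ext h)⟩⟩
    (fun P => {z | ∃ C : X, C.1 ∈ basisSet a P.1 ∧ f C = z}) (by
      rintro ⟨P, hP⟩
      obtain ⟨Q, hQ, hinf⟩ := exists_forall_infinite_inter hdec hnull (a := a) (B := P)
        fun s R h => hdense s R (h.trans (basisSet_mono a hP))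
      -- Points of `X` chosen below almost disjoint sets meet in a finite set, so their labels
      -- differ.
      obtain ⟨A, hA, hAd⟩ := exists_almostDisjoint Q
      choose C hCX hC using fun x => hdense a (A x)
        (basisSet_mono a ((hA x).trans (hQ.trans hP)))
      refine ⟨fun x => f ⟨C x, hCX x⟩, fun x y hxy => ?_,
        fun x => ⟨⟨C x, hCX x⟩, basisSet_mono a ((hA x).trans hQ) (hC x), rfl⟩⟩
      by_contra hne
      refine hinf (C x) (hCX x) (basisSet_mono a (hA x) (hC x)) (C y) (hCX y)
        (basisSet_mono a (hA y) (hC y)) (by rw [hg _ (hCX x), hg _ (hCX y)]; exact hxy) ?_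
      refine (a.finite_toSet.union (hAd x y hne)).subset fun n hn => ?_
      rcases (hC x).2 hn.1 with h | h
      · exact Or.inl h
      rcases (hC y).2 hn.2 with h' | h'
      · exact Or.inl h'
      · exact Or.inr ⟨h, h'⟩)
  obtain ⟨P, hP, h⟩ := exists_decides_of_baireMeasurableSet (hS S) a B
  obtain ⟨⟨_, ⟨C, hC, rfl⟩, hCS⟩, ⟨_, ⟨D, hD, rfl⟩, hDS⟩⟩ := hsplit ⟨P, hP⟩
  rcases h with h | h
  · exact hDS (h D hD)
  · exact h C hC hCS

end EllentuckSpace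

/-! ### From partitions to labellings -/

theorem proposition4 (X : Set EllentuckSpace) (hX : ¬ IsMeagre X) :
    ¬ ∃ F : Set (Set X), IsKuratowskiPartition F := by
  rintro ⟨F, hF, hmeagre, hBaire⟩
  choose cell hcell huniq using hF.2
  have hcellF : ∀ x, cell x ∈ F := fun x => (hcell x).1
  have heq : ∀ x, ∀ b ∈ F, x ∈ b → b = cell x := fun x b hb hx => huniq x b ⟨hb, hx⟩
  choose rep hrep using fun b : F => Setoid.nonempty_of_mem_partition hF b.2
  -- A point of the space is itself a subset of ω, so the representative of a cell serves as its
  -- label.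
  let f : X → Set ℕ := fun x => (rep ⟨cell x, hcellF x⟩).1.1
  have hf : ∀ x y, f x = f y → cell x = cell y := fun x y h => by
    have h' : rep ⟨cell x, hcellF x⟩ = rep ⟨cell y, hcellF y⟩ := Subtype.ext (Subtype.ext h)
    rw [heq _ _ (hcellF x) (hrep ⟨cell x, hcellF x⟩), h',
      ← heq _ _ (hcellF y) (hrep ⟨cell y, hcellF y⟩)]
  refine EllentuckSpace.not_forall_baireMeasurableSet_preimage hX f (fun z => ?_) fun S => ?_
  · by_cases hz : ∃ x, f x = z
    · obtain ⟨x, rfl⟩ := hz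
      exact (hmeagre _ (hcellF x)).mono fun y hy => hf y x hy ▸ (hcell y).2
    · convert IsMeagre.empty (X := X)
      exact Set.eq_empty_of_forall_notMem fun x hx => hz ⟨x, hx⟩
  -- Since `f` is constant on cells, the preimage of `S` is a union of cells.
  · convert hBaire (cell '' (f ⁻¹' S)) (by rintro _ ⟨x, -, rfl⟩; exact hcellF x)
    ext y
    constructor
    · exact fun hy => ⟨cell y, ⟨y, hy, rfl⟩, (hcell y).2⟩
    · rintro ⟨_, ⟨x, hx, rfl⟩, hy⟩
      have h : cell x = cell y := heq y _ (hcellF x) hy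
      have hxy : f x = f y := by simp only [f, h]
      exact Set.mem_preimage.2 (hxy ▸ hx)
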